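/- Let $\mathcal F$ be a family of finite point sets in $\mathbb R^d$. For $\varepsilon>0$, an $\varepsilon$-net of a finite set $P\subset\mathbb R^d$ is a subset $N\subseteq P$ such that every point of $P$ is within distance $\varepsilon$ of a point of $N$ and any two distinct points of $N$ are at distance at least $\varepsilon$. For real $\delta\ge 0$ and $K$, say that $\mathcal F$ satisfies the net bound with exponent $\delta$ and constant $K$ if $|N\cap B(x,r)|\le K(r/\varepsilon)^{\delta}$ for all $P\in\mathcal F$, all $\varepsilon>0$ and $r\ge 2\varepsilon$, all $\varepsilon$-nets $N$ of $P$ and all closed balls $B(x,r)$, $x\in\mathbb R^d$. The fractal dimension $\dim_{\mathsf f}(\mathcal F)$ is the infimum of the $\delta\ge 0$ for which $\mathcal F$ satisfies the net bound with exponent $\delta$ and some constant $K$. **Theorem.** There is an absolute constant $c>0$ such that the following holds for every integer $d\ge 2$ and every real $\delta\in(0,d]$. Let $\mathcal F$ be a family of finite point sets in $\mathbb R^d$ with $\dim_{\mathsf f}(\mathcal F)=\delta$; if $\delta\ge1$, suppose that the infimum is attained, that is, that $\mathcal F$ satisfies the net bound with exponent $\delta$ and some constant. Then for every $P\in\mathcal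 F$ with $n=|P|\ge 2$ and for the edge set $W$ of any optimal (shortest closed) Euclidean TSP tour of $P$, the edges being closed line segments, there is a $(d-1)$-sphere $C$ of positive radius such that at most $(1-2^{-cd})n$ points of $P$ lie strictly inside $C$, at most $(1-2^{-cd})n$ points of $P$ lie strictly outside $C$, and $$|\{w\in W: w\cap C\neq\emptyset\}|=\begin{cases}O(n^{1-1/\delta}) & \text{if }\delta>1,\\ O(\log n)&\text{if }\delta=1,\\ O\left(\dfrac{1}{2^{1-\delta}-1}\right)&\text{if }\delta<1,\end{cases}$$ where the hidden constant does not depend on $P$ or on the tour. Moreover, for every family that satisfies the net bound with exponent $\delta\in(0,d]$ and constant $K$ (so that its fractal dimension is at most $\delta$), the same conclusion holds, with the same $c$, with a hidden constant that depends only on $d$ and $K$ if $\delta\le 1$, and only on $d$, $K$ and $\delta$ if $\delta>1$. -/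

import Mathlib

/-- Euclidean `d`-space. -/
abbrev Euc (d : ℕ) : Type := EuclideanSpace ℝ (Fin d)

/-- `N` is an `ε`-net of the finite set `P`: a subset of `P` that is an `ε`-covering and an
`ε`-packing of `P`. -/
def IsEpsNet {d : ℕ} (ε : ℝ) (N P : Finset (Euc d)) : Prop :=
  N ⊆ P ∧ (∀ x ∈ P, ∃ y ∈ N, dist x y ≤ ε) ∧ (∀ x ∈ N, ∀ y ∈ N, x ≠ y → ε ≤ dist x y)

/-- Every `ε`-net of every member of the family `F` has at most `K * (r / ε) ^ δ` points in any
closed ball of radius `r ≥ 2 * ε`. -/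
def NetBound {d : ℕ} (F : Set (Finset (Euc d))) (δ K : ℝ) : Prop :=
  ∀ P ∈ F, ∀ ε r : ℝ, 0 < ε → 2 * ε ≤ r → ∀ N : Finset (Euc d), IsEpsNet ε N P →
    ∀ x : Euc d, (((N : Set (Euc d)) ∩ Metric.closedBall x r).ncard : ℝ) ≤ K * (r / ε) ^ δ

/-- The exponents `δ` for which the number of net points in balls is `O((r / ε) ^ δ)`, uniformly
over the family. -/
def fractalExponents {d : ℕ} (F : Set (Finset (Euc d))) : Set ℝ :=
  {δ | 0 ≤ δ ∧ ∃ K : ℝ, NetBound F δ K}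

/-- The fractal dimension of a family of finite point sets. -/
noncomputable def fractalDim {d : ℕ} (F : Set (Finset (Euc d))) : ℝ :=
  sInf (fractalExponents F)

/-- A closed tour through `P`, given as a cyclic enumeration of its points. -/
abbrev Tour {d : ℕ} (P : Finset (Euc d)) : Type := Fin P.card ≃ P

/-- The Euclidean length of a tour (`finRotate` is `i ↦ i + 1` modulo the number of points). -/
noncomputable def tourLength {d : ℕ} {P : Finset (Euc d)} (e : Tour P) : ℝ :=
  ∑ i, dist (e i : Euc d) (e (finRotate P.card i) : Euc d)

/-- The tour has minimum length among all tours of `P`. -/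
def IsOptimalTour {d : ℕ} {P : Finset (Euc d)} (e : Tour P) : Prop :=
  ∀ e' : Tour P, tourLength e ≤ tourLength e'

/-- The set of edges of a tour, each edge being a closed line segment. -/
def tourEdges {d : ℕ} {P : Finset (Euc d)} (e : Tour P) : Set (Set (Euc d)) :=
  Set.range fun i => segment ℝ (e i : Euc d) (e (finRotate P.card i) : Euc d)

/-- There is a sphere with at most a `1 - 2 ^ (-(c * d))` fraction of the points of `P` strictly
inside, at most that fraction strictly outside, and that meets at most `M` members of `W`. -/
def HasSphereSeparator {d : ℕ} (c : ℝ) (P : Finset (Euc d)) (W : Set (Set (Euc d))) (M : ℝ) :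
    Prop :=
  ∃ (o : Euc d) (r : ℝ), 0 < r ∧
    (((P : Set (Euc d)) ∩ Metric.ball o r).ncard : ℝ)
      ≤ (1 - (2 : ℝ) ^ (-(c * (d : ℝ)))) * (P.card : ℝ) ∧
    (((P : Set (Euc d)) \ Metric.closedBall o r).ncard : ℝ)
      ≤ (1 - (2 : ℝ) ^ (-(c * (d : ℝ)))) * (P.card : ℝ) ∧
    (({w ∈ W | (w ∩ Metric.sphere o r).Nonempty}).ncard : ℝ) ≤ M

/-- The three growth rates of the number of crossing edges. -/
noncomputable def crossingRate (δ : ℝ) (n : ℕ) : ℝ :=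
  if 1 < δ then (n : ℝ) ^ (1 - 1 / δ)
  else if δ = 1 then Real.log n
  else 1 / ((2 : ℝ) ^ (1 - δ) - 1)

/-!
Take the smallest ball `B(o, r)` centred at a point of `P` that contains more than a
`1 / (2 * 5 ^ d)` fraction of `P`. A ball of radius `2 * r` is covered by `5 ^ d` open balls of
radius `r`, each of which contains at most that fraction by minimality, so every sphere around `o`
of radius `ρ ∈ [r, 2 * r]` is balanced.

An optimal tour cannot be shortened by a 2-opt move. Hence two edges that come close to each other,
compared with their lengths, point in directions at distance more than `1`, and there are only
`5 ^ d` such directions. So boundedly many edges much longer than `r` come near the ball. For the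
edges of length about `2 ^ (-k) * r` the same packing, applied around the points of a net at that
scale, and the net bound give `O((2 ^ k) ^ δ)` edges. An edge of length `l` meets the sphere for a
set of radii `ρ` of measure at most `2 * l`, so for a suitable `ρ` the number of crossings is
`O(∑ (2 ^ (-k)) * (2 ^ k) ^ δ)`, where the sum stops at the scale at which the trivial bound `n` on
the number of edges is better.
-/

open scoped Finset
open Module (finrank)

section Tours

/-- The permutation of `Fin n` that reverses the interval of indices `k` with `a ≤ k ≤ b`. Reversing
a stretch of a closed tour is the elementary 2-opt move. -/
def reverseInterval {n : ℕ} (a : ℕ) (b : Fin n) : Equiv.Perm (Fin n) :=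
  Function.Involutive.toPerm
    (fun k => if h : a ≤ k ∧ (k : ℕ) ≤ b then ⟨a + b - k, by omega⟩ else k) (by
      intro k
      ext
      grind)

theorem coe_reverseInterval {n : ℕ} (a : ℕ) (b k : Fin n) :
    (reverseInterval a b k : ℕ) = if a ≤ k ∧ (k : ℕ) ≤ b then a + b - k else k := by
  change ((if h : a ≤ k ∧ (k : ℕ) ≤ b then ⟨a + b - k, by omega⟩ else k : Fin n) : ℕ) = _
  split_ifs <;> rfl

theorem coe_finRotate_eq_ite {n : ℕ} (k : Fin n) :
    (finRotate n k : ℕ) = if (k : ℕ) + 1 < n then (k : ℕ) + 1 else 0 := by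
  cases n with
  | zero => exact k.elim0
  | succ n => grind [coe_finRotate]

theorem sum_reverseInterval_add {n : ℕ} {M : Type*} [AddCommGroup M] (g : Fin n → Fin n → M)
    (hg : ∀ a b, g a b = g b a) {i j : Fin n} (hij : i < j) :
    ∑ k, g (reverseInterval (i + 1) j k) (reverseInterval (i + 1) j (finRotate n k))
      + (g i (finRotate n i) + g j (finRotate n j)) =
    ∑ k, g k (finRotate n k) + (g i j + g (finRotate n i) (finRotate n j)) := by
  set σ := reverseInterval ((i : ℕ) + 1) j with hσ
  set τ := reverseInterval (i : ℕ) j with hτ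
  have : (i : ℕ) < j := hij
  have := j.isLt
  have hi : σ i = i ∧ σ (finRotate n i) = j ∧ τ i = j := by
    simp only [Fin.ext_iff, hσ, hτ, coe_reverseInterval, coe_finRotate_eq_ite]
    refine ⟨?_, ?_, ?_⟩ <;> split_ifs <;> omega
  have hj : σ j = finRotate n i ∧ σ (finRotate n j) = finRotate n j ∧ τ j = i := by
    simp only [Fin.ext_iff, hσ, hτ, coe_reverseInterval, coe_finRotate_eq_ite]
    refine ⟨?_, ?_, ?_⟩ <;> split_ifs <;> omega
  -- Apart from `i` and `j`, the edge at position `k` of the new tour is the edge of the old one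
  -- at position `τ k`, traversed backwards inside the stretch.
  have hedge : ∀ k, k ≠ i ∧ k ≠ j →
      g (σ k) (σ (finRotate n k)) - g (τ k) (finRotate n (τ k)) = 0 := by
    intro k hk
    have := k.isLt
    rw [sub_eq_zero]
    simp only [ne_eq, Fin.ext_iff] at hk
    by_cases h : (i : ℕ) ≤ k ∧ (k : ℕ) ≤ j
    · have hrev : σ k = finRotate n (τ k) ∧ σ (finRotate n k) = τ k := by
        simp only [Fin.ext_iff, hσ, hτ, coe_reverseInterval, coe_finRotate_eq_ite]
        constructor <;> split_ifs <;> omega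
      rw [hrev.1, hrev.2, hg]
    · have hfix : σ k = k ∧ σ (finRotate n k) = finRotate n k ∧ τ k = k := by
        simp only [Fin.ext_iff, hσ, hτ, coe_reverseInterval, coe_finRotate_eq_ite]
        refine ⟨?_, ?_, ?_⟩ <;> split_ifs <;> omega
      rw [hfix.1, hfix.2.1, hfix.2.2]
  have hsum := Fintype.sum_eq_add i j hij.ne hedge
  rw [Finset.sum_sub_distrib, Equiv.sum_comp τ (fun k => g k (finRotate n k)), hi.1, hi.2.1,
    hi.2.2, hj.1, hj.2.1, hj.2.2, sub_eq_iff_eq_add] at hsum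
  rw [hsum]
  abel

/-- The oriented edges `v` and `w` are not shortened by the 2-opt move, which joins the starting
points of `v` and `w` to each other, and the end points likewise. -/
def ExchangeStable {X : Type*} [PseudoMetricSpace X] (v w : X × X) : Prop :=
  dist v.1 v.2 + dist w.1 w.2 ≤ dist v.1 w.1 + dist v.2 w.2

theorem ExchangeStable.symm {X : Type*} [PseudoMetricSpace X] {v w : X × X}
    (h : ExchangeStable v w) : ExchangeStable w v := by
  simpa only [ExchangeStable, add_comm (dist w.1 w.2), dist_comm w.1 v.1, dist_comm w.2 v.2] using h

/-- `W` is a set of oriented edges that start in `P`, at most one per point of `P` on average, which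
no 2-opt move shortens. This is all that the argument uses of an optimal tour; 2-opt local minima
and the minimum perfect matchings are other examples. -/
structure IsTwoOptimal {X : Type*} [PseudoMetricSpace X] (P : Finset X) (W : Finset (X × X)) :
    Prop where
  fst_mem : ∀ w ∈ W, w.1 ∈ P
  card_le : #W ≤ #P
  pairwise : (W : Set (X × X)).Pairwise ExchangeStable

variable {d : ℕ} {P : Finset (Euc d)}

/-- The edges of a tour, oriented along the tour. -/
def orientedEdges (e : Tour P) : Finset (Euc d × Euc d) :=
  Finset.univ.map ⟨fun i => (e i, e (finRotate _ i)), fun _ _ h =>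
    e.injective (Subtype.ext (congrArg Prod.fst h))⟩

theorem image_segment_orientedEdges (e : Tour P) :
    (fun w : Euc d × Euc d => segment ℝ w.1 w.2) '' orientedEdges e = tourEdges e := by
  simp [orientedEdges, tourEdges, ← Set.range_comp, Function.comp_def]

theorem IsOptimalTour.exchangeStable {e : Tour P} (he : IsOptimalTour e) {i j : Fin #P}
    (hij : i ≠ j) :
    ExchangeStable ((e i : Euc d), (e (finRotate _ i) : Euc d))
      ((e j : Euc d), (e (finRotate _ j) : Euc d)) := by
  wlog h : i < j generalizing i j
  · exact (this hij.symm (hij.symm.lt_of_le (not_lt.1 h))).symm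
  have hopt := he ((reverseInterval (i + 1) j).trans e)
  have hsum := sum_reverseInterval_add (fun a b => dist (e a : Euc d) (e b))
    (fun _ _ => dist_comm _ _) h
  simp only [tourLength, Equiv.trans_apply] at hopt
  simp only [ExchangeStable]
  linarith

theorem IsOptimalTour.isTwoOptimal {e : Tour P} (he : IsOptimalTour e) :
    IsTwoOptimal P (orientedEdges e) where
  fst_mem := by simp [orientedEdges]
  card_le := by simp [orientedEdges]
  pairwise := by
    simp only [orientedEdges, Finset.coe_map, Finset.coe_univ, Set.image_univ]
    rintro _ ⟨i, rfl⟩ _ ⟨j, rfl⟩ hne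
    exact he.exchangeStable fun h => hne (h ▸ rfl)

end Tours

section Metric

variable {X : Type*}

theorem exists_maximal_separated [PseudoMetricSpace X] (Q : Finset X) {ε : ℝ} (hε : 0 < ε) :
    ∃ N ⊆ Q, (∀ x ∈ Q, ∃ y ∈ N, dist x y < ε) ∧ (N : Set X).Pairwise fun x y => ε ≤ dist x y := by
  classical
  let S := Q.powerset.filter fun N : Finset X => (N : Set X).Pairwise fun x y => ε ≤ dist x y
  obtain ⟨N, hN⟩ : ∃ N, Maximal (· ∈ S) N := Finset.exists_maximal ⟨∅, by simp [S]⟩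
  obtain ⟨hNQ, hsep⟩ : N ⊆ Q ∧ (N : Set X).Pairwise fun x y => ε ≤ dist x y := by
    simpa [S] using hN.prop
  refine ⟨N, hNQ, fun x hx => ?_, hsep⟩
  by_contra! hfar
  have hins : insert x N ∈ S := by
    rw [Finset.mem_filter, Finset.mem_powerset, Finset.coe_insert]
    refine ⟨Finset.insert_subset hx hNQ, hsep.insert fun y hy _ => ⟨hfar y hy, ?_⟩⟩
    exact (hfar y hy).trans_eq (dist_comm x y)
  have hxN : x ∈ N := hN.le_of_ge hins (Finset.subset_insert x N) (Finset.mem_insert_self x N)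
  exact absurd (hfar x hxN) (by simpa using hε)

/-- `IsEpsNet` in an arbitrary metric space. -/
def IsNet [PseudoMetricSpace X] (ε : ℝ) (N P : Finset X) : Prop :=
  N ⊆ P ∧ (∀ x ∈ P, ∃ y ∈ N, dist x y ≤ ε) ∧ (∀ x ∈ N, ∀ y ∈ N, x ≠ y → ε ≤ dist x y)

/-- The net bound with exponent `δ` and constant `K` for a single set in an arbitrary metric space;
`NetBound F δ K` says that all members of `F` satisfy it. -/
def HasNetBound [PseudoMetricSpace X] (P : Finset X) (δ K : ℝ) : Prop :=
  ∀ ε r : ℝ, 0 < ε → 2 * ε ≤ r → ∀ N : Finset X, IsNet ε N P →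
    ∀ x : X, (((N : Set X) ∩ Metric.closedBall x r).ncard : ℝ) ≤ K * (r / ε) ^ δ

/-- `fractalExponents` in an arbitrary metric space. -/
def netExponents [PseudoMetricSpace X] (F : Set (Finset X)) : Set ℝ :=
  {δ | 0 ≤ δ ∧ ∃ K : ℝ, ∀ P ∈ F, HasNetBound P δ K}

/-- There is a sphere with at most a fraction `β` of the points of `P` strictly inside, at most that
fraction strictly outside, and that meets at most `M` members of `W`. It generalizes
`HasSphereSeparator` to an arbitrary metric space and to an arbitrary balance. -/
def HasBalancedSphere [PseudoMetricSpace X] (β : ℝ) (P : Finset X) (W : Set (Set X)) (M : ℝ) :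
    Prop :=
  ∃ (o : X) (r : ℝ), 0 < r ∧
    (((P : Set X) ∩ Metric.ball o r).ncard : ℝ) ≤ β * #P ∧
    (((P : Set X) \ Metric.closedBall o r).ncard : ℝ) ≤ β * #P ∧
    (({w ∈ W | (w ∩ Metric.sphere o r).Nonempty}).ncard : ℝ) ≤ M

theorem HasBalancedSphere.mono [PseudoMetricSpace X] {β β' M M' : ℝ} {P : Finset X}
    {W : Set (Set X)} (h : HasBalancedSphere β P W M) (hβ : β ≤ β') (hM : M ≤ M') :
    HasBalancedSphere β' P W M' := by
  obtain ⟨o, r, hr, hin, hout, hW⟩ := h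
  exact ⟨o, r, hr, hin.trans (by gcongr), hout.trans (by gcongr), hW.trans hM⟩

theorem exists_isNet [PseudoMetricSpace X] (P : Finset X) {ε : ℝ} (hε : 0 < ε) :
    ∃ N, IsNet ε N P := by
  obtain ⟨N, hN, hcov, hsep⟩ := exists_maximal_separated P hε
  exact ⟨N, hN, fun x hx => (hcov x hx).imp fun y hy => ⟨hy.1, hy.2.le⟩,
    fun x hx y hy hxy => hsep hx hy hxy⟩

theorem exists_minimal_closedBall [MetricSpace X] (P : Finset X) {m : ℕ} (hm : 2 ≤ m)
    (hmP : m ≤ #P) :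
    ∃ (o : X) (r : ℝ), 0 < r ∧ m ≤ #{x ∈ P | dist x o ≤ r} ∧
      ∀ p ∈ P, #{x ∈ P | dist x p < r} < m := by
  classical
  have hfarthest : ∀ p, ∀ Q ⊆ P, m ≤ #Q → ∃ y ∈ Q, m ≤ #{x ∈ P | dist x p ≤ dist y p} := by
    intro p Q hQ hcard
    obtain ⟨y, hy, hmax⟩ := Q.exists_max_image (dist · p) (Finset.card_pos.1 (by omega))
    exact ⟨y, hy, hcard.trans (Finset.card_le_card fun x hx =>
      Finset.mem_filter.2 ⟨hQ hx, hmax x hx⟩)⟩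
  obtain ⟨p₀, hp₀⟩ : P.Nonempty := Finset.card_pos.1 (by omega)
  obtain ⟨y₀, hy₀, hcard₀⟩ := hfarthest p₀ P subset_rfl hmP
  obtain ⟨⟨o, y⟩, hoy, hmin⟩ := Finset.exists_min_image
    {z ∈ P ×ˢ P | m ≤ #{x ∈ P | dist x z.1 ≤ dist z.2 z.1}} (fun z => dist z.2 z.1)
    ⟨(p₀, y₀), by simp [hp₀, hy₀, hcard₀]⟩
  have hcard : m ≤ #{x ∈ P | dist x o ≤ dist y o} := (Finset.mem_filter.1 hoy).2
  refine ⟨o, dist y o, dist_pos.2 ?_, hcard, fun p hp => ?_⟩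
  · rintro rfl
    have hsub : {x ∈ P | dist x y ≤ dist y y} ⊆ {y} := fun x hx => by
      simpa using (Finset.mem_filter.1 hx).2
    have := Finset.card_le_card hsub
    rw [Finset.card_singleton] at this
    omega
  · by_contra! hle
    obtain ⟨z, hz, hzcard⟩ := hfarthest p _ (Finset.filter_subset _ _) hle
    rw [Finset.mem_filter] at hz
    exact (hmin (p, z) (by simp [hp, hz.1, hzcard])).not_gt hz.2

theorem exists_sphere_ncard_add_one_le [MetricSpace X] {P : Finset X} (hP : 2 ≤ #P) :
    ∃ (o : X) (r : ℝ), 0 < r ∧ ((P : Set X) ∩ Metric.ball o r).ncard + 1 ≤ #P ∧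
      ((P : Set X) \ Metric.closedBall o r).ncard + 1 ≤ #P := by
  obtain ⟨p, -, q, hq, hpq⟩ := Finset.one_lt_card.1 hP
  have hlt : ∀ s : Set X, s ⊆ P → q ∉ s → s.ncard + 1 ≤ #P := fun s hs hqs => by
    rw [← Set.ncard_coe_finset]
    exact Set.ncard_lt_ncard (hs.ssubset_of_mem_notMem hq hqs)
  exact ⟨p, dist q p, dist_pos.2 hpq.symm, hlt _ Set.inter_subset_left (by simp),
    hlt _ Set.sdiff_subset (by simp)⟩

end Metric

section Normed

variable {E : Type*} [NormedAddCommGroup E] [NormedSpace ℝ E]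

theorem norm_smul_sub_smul_le_max {u v : E} (hu : ‖u‖ ≤ 1) (hv : ‖v‖ ≤ 1) (huv : ‖u - v‖ ≤ 1)
    {x y : ℝ} (hx : 0 ≤ x) (hy : 0 ≤ y) : ‖x • u - y • v‖ ≤ max x y := by
  wlog hxy : x ≤ y generalizing x y u v
  · rw [norm_sub_rev, max_comm]
    exact this hv hu (norm_sub_rev u v ▸ huv) hy hx (le_of_not_ge hxy)
  calc ‖x • u - y • v‖ = ‖x • (u - v) - (y - x) • v‖ := by congr 1; module
    _ ≤ ‖x • (u - v)‖ + ‖(y - x) • v‖ := norm_sub_le _ _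
    _ = x * ‖u - v‖ + (y - x) * ‖v‖ := by
      rw [norm_smul_of_nonneg hx, norm_smul_of_nonneg (sub_nonneg.2 hxy)]
    _ ≤ x * 1 + (y - x) * 1 := by
      have := sub_nonneg.2 hxy
      gcongr
    _ = max x y := by rw [max_eq_right hxy]; ring

/-- The unit vector that points along an oriented edge (`0` if the edge is a single point). -/
noncomputable def direction (w : E × E) : E := (dist w.1 w.2)⁻¹ • (w.2 - w.1)

theorem norm_direction {w : E × E} (hw : 0 < dist w.1 w.2) : ‖direction w‖ = 1 := by
  rw [direction, norm_smul_of_nonneg (by positivity), ← dist_eq_norm', inv_mul_cancel₀ hw.ne']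

theorem dist_smul_direction (w : E × E) : dist w.1 w.2 • direction w = w.2 - w.1 := by
  rcases eq_or_ne (dist w.1 w.2) 0 with h | h
  · simp [dist_eq_zero.1 h]
  · rw [direction, smul_inv_smul₀ h]

theorem sub_dist_smul_direction {w : E × E} {p : E} (hp : p ∈ segment ℝ w.1 w.2) :
    p - dist w.1 p • direction w = w.1 := by
  rw [segment_eq_image_lineMap] at hp
  obtain ⟨t, ht, rfl⟩ := hp
  rw [dist_left_lineMap, Real.norm_of_nonneg ht.1, mul_smul, dist_smul_direction,
    AffineMap.lineMap_apply_module']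
  abel

theorem add_dist_smul_direction {w : E × E} {p : E} (hp : p ∈ segment ℝ w.1 w.2) :
    p + dist p w.2 • direction w = w.2 := by
  rw [segment_eq_image_lineMap] at hp
  obtain ⟨t, ht, rfl⟩ := hp
  rw [dist_lineMap_right, Real.norm_of_nonneg (sub_nonneg.2 ht.2), mul_smul, dist_smul_direction,
    AffineMap.lineMap_apply_module']
  module

-- If the directions were at distance at most `1`, replacing the two edges by `v.1 w.1` and
-- `v.2 w.2` would save the common lengths before and after `p` and `q`, at the cost of `2 ‖p - q‖`.
theorem ExchangeStable.one_lt_dist_direction {v w : E × E} (h : ExchangeStable v w)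
    (hv : 0 < dist v.1 v.2) (hw : 0 < dist w.1 w.2) {p q : E} (hp : p ∈ segment ℝ v.1 v.2)
    (hq : q ∈ segment ℝ w.1 w.2)
    (hpq : 2 * dist p q < min (dist v.1 p) (dist w.1 q) + min (dist p v.2) (dist q w.2)) :
    1 < dist (direction v) (direction w) := by
  by_contra! hdir
  rw [dist_eq_norm] at hdir
  have hmax : ∀ {x y : ℝ}, 0 ≤ x → 0 ≤ y → ‖x • direction v - y • direction w‖ ≤ max x y :=
    fun hx hy => norm_smul_sub_smul_le_max (norm_direction hv).le (norm_direction hw).le hdir hx hy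
  have hfst : dist v.1 w.1 ≤ dist p q + max (dist v.1 p) (dist w.1 q) :=
    calc dist v.1 w.1 = dist (p - dist v.1 p • direction v) (q - dist w.1 q • direction w) := by
          rw [sub_dist_smul_direction hp, sub_dist_smul_direction hq]
      _ ≤ dist p q + dist (dist v.1 p • direction v) (dist w.1 q • direction w) :=
          dist_sub_sub_le _ _ _ _
      _ ≤ dist p q + max (dist v.1 p) (dist w.1 q) := by
          rw [dist_eq_norm (_ • _)]
          gcongr
          exact hmax dist_nonneg dist_nonneg
  have hsnd : dist v.2 w.2 ≤ dist p q + max (dist p v.2) (dist q w.2) :=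
    calc dist v.2 w.2 = dist (p + dist p v.2 • direction v) (q + dist q w.2 • direction w) := by
          rw [add_dist_smul_direction hp, add_dist_smul_direction hq]
      _ ≤ dist p q + dist (dist p v.2 • direction v) (dist q w.2 • direction w) :=
          dist_add_add_le _ _ _ _
      _ ≤ dist p q + max (dist p v.2) (dist q w.2) := by
          rw [dist_eq_norm (_ • _)]
          gcongr
          exact hmax dist_nonneg dist_nonneg
  have hv := dist_add_dist_of_mem_segment hp
  have hw := dist_add_dist_of_mem_segment hq
  have := min_add_max (dist v.1 p) (dist w.1 q)
  have := min_add_max (dist p v.2) (dist q w.2)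
  simp only [ExchangeStable] at h
  linarith

end Normed

section FiniteDimensional

variable {E : Type*} [NormedAddCommGroup E] [NormedSpace ℝ E] [FiniteDimensional ℝ E]

theorem card_le_of_dist_le_two_mul_of_separated {ι : Type*} (J : Finset ι) (x : ι → E) {o : E}
    {r : ℝ} (hr : 0 < r) (hball : ∀ i ∈ J, dist (x i) o ≤ 2 * r)
    (hsep : ∀ i ∈ J, ∀ j ∈ J, i ≠ j → r ≤ dist (x i) (x j)) :
    #J ≤ 5 ^ finrank ℝ E := by
  classical
  let f : ι → E := fun i => r⁻¹ • (x i - o)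
  have hf : ∀ i j, ‖f i - f j‖ = r⁻¹ * dist (x i) (x j) := fun i j => by
    rw [← smul_sub, sub_sub_sub_cancel_right, norm_smul_of_nonneg (by positivity), dist_eq_norm]
  have hfsep : ∀ i ∈ J, ∀ j ∈ J, i ≠ j → 1 ≤ ‖f i - f j‖ := fun i hi j hj hij => by
    rw [hf, ← inv_mul_cancel₀ hr.ne']
    gcongr
    exact hsep i hi j hj hij
  have hinj : Set.InjOn f J := fun i hi j hj hij => by
    by_contra hne
    have := hfsep i hi j hj hne
    rw [hij, sub_self, norm_zero] at this
    exact absurd this (by norm_num)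
  rw [← Finset.card_image_of_injOn hinj]
  refine Besicovitch.card_le_of_separated _ ?_ ?_
  · simp only [Finset.forall_mem_image, f]
    intro i hi
    rw [norm_smul_of_nonneg (by positivity), ← dist_eq_norm, inv_mul_le_iff₀ hr, mul_comm]
    exact hball i hi
  · simp only [Finset.forall_mem_image]
    exact fun i hi j hj hij => hfsep i hi j hj fun h => hij (h ▸ rfl)

theorem card_le_of_pairwise_exchangeStable_of_close {W : Finset (E × E)}
    (hW : (W : Set (E × E)).Pairwise ExchangeStable) {L : ℝ}
    (hlen : ∀ w ∈ W, L ≤ dist w.1 w.2) (p : E × E → E)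
    (hp : ∀ w ∈ W, p w ∈ segment ℝ w.1 w.2) (hclose : ∀ v ∈ W, ∀ w ∈ W, dist (p v) (p w) < L / 4) :
    #W ≤ 2 * 5 ^ finrank ℝ E := by
  have hpos : ∀ w ∈ W, 0 < dist w.1 w.2 := fun w hw => by
    linarith [hlen w hw, hclose w hw w hw, dist_self (p w)]
  have hcard : ∀ V ⊆ W, (∀ v ∈ V, ∀ w ∈ V, L / 2 ≤
      min (dist v.1 (p v)) (dist w.1 (p w)) + min (dist (p v) v.2) (dist (p w) w.2)) →
      #V ≤ 5 ^ finrank ℝ E := by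
    intro V hV hmin
    refine card_le_of_dist_le_two_mul_of_separated V direction (o := 0) one_pos ?_ ?_
    · intro v hv
      rw [dist_zero_right, norm_direction (hpos v (hV hv))]
      norm_num
    · intro v hv w hw hne
      refine ((hW (hV hv) (hV hw) hne).one_lt_dist_direction (hpos v (hV hv)) (hpos w (hV hw))
        (hp v (hV hv)) (hp w (hV hw)) ?_).le
      linarith [hmin v hv w hw, hclose v (hV hv) w (hV hw)]
  -- Each edge extends by at least half of its length on one side of its marked point.
  have hbefore : #{w ∈ W | L / 2 ≤ dist w.1 (p w)} ≤ 5 ^ finrank ℝ E := by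
    refine hcard _ (Finset.filter_subset _ _) fun v hv w hw => ?_
    have := le_min (Finset.mem_filter.1 hv).2 (Finset.mem_filter.1 hw).2
    have : 0 ≤ min (dist (p v) v.2) (dist (p w) w.2) := le_min dist_nonneg dist_nonneg
    linarith
  have hafter : #{w ∈ W | ¬ L / 2 ≤ dist w.1 (p w)} ≤ 5 ^ finrank ℝ E := by
    have hhalf : ∀ w ∈ {w ∈ W | ¬ L / 2 ≤ dist w.1 (p w)}, L / 2 ≤ dist (p w) w.2 := fun w hw => by
      obtain ⟨hwW, hlt⟩ := Finset.mem_filter.1 hw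
      linarith [hlen w hwW, dist_add_dist_of_mem_segment (hp w hwW)]
    refine hcard _ (Finset.filter_subset _ _) fun v hv w hw => ?_
    have := le_min (hhalf v hv) (hhalf w hw)
    have : 0 ≤ min (dist v.1 (p v)) (dist w.1 (p w)) := le_min dist_nonneg dist_nonneg
    linarith
  rw [← Finset.card_filter_add_card_filter_not (s := W) (fun w => L / 2 ≤ dist w.1 (p w))]
  omega

theorem card_filter_closedBall_two_mul_le (P : Finset E) {r : ℝ} (hr : 0 < r) {k : ℕ}
    (hk : ∀ p ∈ P, #{x ∈ P | dist x p < r} ≤ k) (o : E) :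
    #{x ∈ P | dist x o ≤ 2 * r} ≤ k * 5 ^ finrank ℝ E := by
  classical
  obtain ⟨N, hN, hcov, hsep⟩ := exists_maximal_separated {x ∈ P | dist x o ≤ 2 * r} hr
  have hNball : ∀ y ∈ N, y ∈ P ∧ dist y o ≤ 2 * r := fun y hy => Finset.mem_filter.1 (hN hy)
  calc #{x ∈ P | dist x o ≤ 2 * r} ≤ #(N.biUnion fun y => {x ∈ P | dist x y < r}) := by
        refine Finset.card_le_card fun x hx => ?_
        obtain ⟨y, hy, hxy⟩ := hcov x hx
        exact Finset.mem_biUnion.2 ⟨y, hy, Finset.mem_filter.2 ⟨(Finset.mem_filter.1 hx).1, hxy⟩⟩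
    _ ≤ #N * k := Finset.card_biUnion_le_card_mul _ _ _ fun y hy => hk y (hNball y hy).1
    _ ≤ 5 ^ finrank ℝ E * k := by
        gcongr
        exact card_le_of_dist_le_two_mul_of_separated N id hr (fun y hy => (hNball y hy).2)
          fun x hx y hy hxy => hsep hx hy hxy
    _ = k * 5 ^ finrank ℝ E := mul_comm _ _

theorem exists_annulus_ncard_le {P : Finset E} (hP : 2 * 5 ^ finrank ℝ E < #P) :
    ∃ (o : E) (r : ℝ), 0 < r ∧ ∀ ρ ∈ Set.Icc r (2 * r),
      2 * ((P : Set E) ∩ Metric.ball o ρ).ncard ≤ #P ∧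
      ((P : Set E) \ Metric.closedBall o ρ).ncard + #P / (2 * 5 ^ finrank ℝ E) < #P := by
  classical
  set D := 5 ^ finrank ℝ E
  have hD : 0 < D := by positivity
  set k := #P / (2 * D)
  have hk : 1 ≤ k := (Nat.one_le_div_iff (by positivity)).2 hP.le
  have hkP : k * (2 * D) ≤ #P := Nat.div_mul_le_self _ _
  obtain ⟨o, r, hr, hin, hopen⟩ :=
    exists_minimal_closedBall P (m := k + 1) (by omega) (by nlinarith)
  have hdouble : #{x ∈ P | dist x o ≤ 2 * r} ≤ k * D :=
    card_filter_closedBall_two_mul_le P hr (fun p hp => Nat.lt_succ_iff.1 (hopen p hp)) o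
  refine ⟨o, r, hr, fun ρ hρ => ⟨?_, ?_⟩⟩
  · have hsub : (P : Set E) ∩ Metric.ball o ρ ⊆ ({x ∈ P | dist x o ≤ 2 * r} : Finset E) :=
      fun x hx => Finset.mem_coe.2 (Finset.mem_filter.2 ⟨hx.1, hx.2.le.trans hρ.2⟩)
    have hle := (Set.ncard_le_ncard hsub (Finset.finite_toSet _)).trans_eq (Set.ncard_coe_finset _)
    calc _ ≤ 2 * (k * D) := by gcongr; exact hle.trans hdouble
      _ = k * (2 * D) := by ring
      _ ≤ #P := hkP
  · have hsub : (P : Set E) \ Metric.closedBall o ρ ⊆ ({x ∈ P | ¬ dist x o ≤ r} : Finset E) :=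
      fun x hx => Finset.mem_coe.2 (Finset.mem_filter.2 ⟨hx.1, fun h => hx.2 (h.trans hρ.1)⟩)
    have hle := (Set.ncard_le_ncard hsub (Finset.finite_toSet _)).trans_eq (Set.ncard_coe_finset _)
    have hsplit := Finset.card_filter_add_card_filter_not (s := P) (fun x => dist x o ≤ r)
    omega

theorem exists_balanced_annulus {P : Finset E} (hP : 2 * 5 ^ finrank ℝ E < #P) :
    ∃ (o : E) (r : ℝ), 0 < r ∧ ∀ ρ ∈ Set.Icc r (2 * r),
      (((P : Set E) ∩ Metric.ball o ρ).ncard : ℝ) ≤ (1 - 1 / (2 * 5 ^ finrank ℝ E)) * #P ∧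
      (((P : Set E) \ Metric.closedBall o ρ).ncard : ℝ) ≤
        (1 - 1 / (2 * 5 ^ finrank ℝ E)) * #P := by
  obtain ⟨o, r, hr, hnat⟩ := exists_annulus_ncard_le hP
  refine ⟨o, r, hr, fun ρ hρ => ?_⟩
  obtain ⟨hin, hout⟩ := hnat ρ hρ
  constructor
  · have hhalf : 2 * (((P : Set E) ∩ Metric.ball o ρ).ncard : ℝ) ≤ #P := by exact_mod_cast hin
    have hfrac : 1 / (2 * 5 ^ finrank ℝ E : ℝ) ≤ 1 / 2 := by
      gcongr
      linarith [one_le_pow₀ (n := finrank ℝ E) (by norm_num : (1 : ℝ) ≤ 5)]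
    nlinarith [Nat.cast_nonneg (α := ℝ) #P]
  · have hdiv : (#P : ℝ) / (2 * 5 ^ finrank ℝ E) <
        (#P / (2 * 5 ^ finrank ℝ E) : ℕ) + 1 := by
      rw [div_lt_iff₀' (by positivity)]
      exact_mod_cast Nat.lt_mul_div_succ #P (by positivity : 0 < 2 * 5 ^ finrank ℝ E)
    have hout' : (((P : Set E) \ Metric.closedBall o ρ).ncard : ℝ) +
        ((#P / (2 * 5 ^ finrank ℝ E) : ℕ) + 1) ≤ #P := by
      exact_mod_cast hout
    rw [sub_mul, one_mul, one_div_mul_eq_div]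
    linarith

end FiniteDimensional

section Averaging

open MeasureTheory
open scoped ENNReal

open scoped Classical in
theorem exists_card_filter_mem_mul_measure_le {α ι : Type*} [MeasurableSpace α] {μ : Measure α}
    {I : Set α} (hI₀ : μ I ≠ 0) (hI : μ I ≠ ∞) (G : Finset ι) {S : ι → Set α}
    (hS : ∀ i, MeasurableSet (S i)) :
    ∃ x ∈ I, (#{i ∈ G | x ∈ S i} : ℝ≥0∞) * μ I ≤ ∑ i ∈ G, μ (S i) := by
  have hmeas : ∀ i, Measurable ((S i).indicator (1 : α → ℝ≥0∞)) :=
    fun i => measurable_one.indicator (hS i)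
  obtain ⟨x, hx, hle⟩ := exists_le_setLAverage hI₀ hI
    (Finset.measurable_fun_sum G fun i _ => hmeas i).aemeasurable
  refine ⟨x, hx, ?_⟩
  calc (#{i ∈ G | x ∈ S i} : ℝ≥0∞) * μ I = (∑ i ∈ G, (S i).indicator 1 x) * μ I := by
        simp [Set.indicator_apply]
    _ ≤ (⨍⁻ y in I, ∑ i ∈ G, (S i).indicator 1 y ∂μ) * μ I := by gcongr
    _ = ∑ i ∈ G, μ.restrict I (S i) := by
      rw [mul_comm, measure_mul_setLAverage _ hI, lintegral_finsetSum _ fun i _ => hmeas i]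
      simp only [lintegral_indicator_one (hS _)]
    _ ≤ ∑ i ∈ G, μ (S i) := by gcongr; exact Measure.restrict_le_self

theorem exists_card_filter_abs_sub_le {ι : Type*} (G : Finset ι) (c l : ι → ℝ)
    (hl : ∀ i ∈ G, 0 ≤ l i) {r : ℝ} (hr : 0 < r) :
    ∃ ρ ∈ Set.Icc r (2 * r), (#{i ∈ G | |ρ - c i| ≤ l i} : ℝ) ≤ 2 * (∑ i ∈ G, l i) / r := by
  have hvol : volume (Set.Icc r (2 * r)) = ENNReal.ofReal r := by
    rw [Real.volume_Icc]; congr 1; ring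
  obtain ⟨ρ, hρ, hle⟩ := exists_card_filter_mem_mul_measure_le
    (μ := volume) (I := Set.Icc r (2 * r)) (by simpa [hvol] using hr) (by simp [hvol]) G
    (fun i => measurableSet_Icc (a := c i - l i) (b := c i + l i))
  refine ⟨ρ, hρ, ?_⟩
  have hmem : ∀ i, ρ ∈ Set.Icc (c i - l i) (c i + l i) ↔ |ρ - c i| ≤ l i := fun i => by
    rw [abs_sub_comm, Set.mem_Icc_iff_abs_le]
  rw [le_div_iff₀ hr, Finset.mul_sum, ← ENNReal.ofReal_le_ofReal_iff
    (Finset.sum_nonneg fun i hi => mul_nonneg zero_le_two (hl i hi)),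
    ENNReal.ofReal_mul (Nat.cast_nonneg _), ENNReal.ofReal_natCast,
    ENNReal.ofReal_sum_of_nonneg fun i hi => mul_nonneg zero_le_two (hl i hi)]
  simpa [hmem, hvol, Real.volume_Icc, ← two_mul] using hle

end Averaging

section Dyadic

theorem le_sum_dyadic_add {R x : ℝ} (hR : 0 ≤ R) (hx : x ≤ R) (T : ℕ) :
    x ≤ ∑ k ∈ Finset.range T, (if R / 2 ^ (k + 1) ≤ x then R / 2 ^ (k + 1) else 0) + R / 2 ^ T := by
  induction T with
  | zero => simpa using hx
  | succ T ih =>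
    rw [Finset.sum_range_succ]
    split_ifs with h
    · have hhalves : R / 2 ^ (T + 1) + R / 2 ^ (T + 1) = R / 2 ^ T := by
        rw [← add_div, pow_succ, ← two_mul, mul_comm, mul_div_mul_right _ _ two_ne_zero]
      linarith
    · have : 0 ≤ ∑ k ∈ Finset.range T, (if R / 2 ^ (k + 1) ≤ x then R / 2 ^ (k + 1) else 0) :=
        Finset.sum_nonneg fun k _ => by split_ifs <;> positivity
      linarith

theorem sum_le_sum_dyadic_card {ι : Type*} (G : Finset ι) (l : ι → ℝ) {R : ℝ} (hR : 0 ≤ R)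
    (hl : ∀ i ∈ G, l i ≤ R) (T : ℕ) :
    ∑ i ∈ G, l i ≤
      ∑ k ∈ Finset.range T, R / 2 ^ (k + 1) * #{i ∈ G | R / 2 ^ (k + 1) ≤ l i} +
        R / 2 ^ T * #G :=
  calc ∑ i ∈ G, l i ≤ ∑ i ∈ G,
        (∑ k ∈ Finset.range T, (if R / 2 ^ (k + 1) ≤ l i then R / 2 ^ (k + 1) else 0) +
          R / 2 ^ T) :=
        Finset.sum_le_sum fun i hi => le_sum_dyadic_add hR (hl i hi) T
    _ = _ := by
        rw [Finset.sum_add_distrib, Finset.sum_comm, Finset.sum_const, nsmul_eq_mul,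
          mul_comm (#G : ℝ)]
        simp only [← Finset.sum_filter, Finset.sum_const, nsmul_eq_mul, mul_comm]

end Dyadic

section Rates

theorem half_le_crossingRate {δ : ℝ} (hδ : 0 < δ) {n : ℕ} (hn : 2 ≤ n) :
    1 / 2 ≤ crossingRate δ n := by
  have hn' : (2 : ℝ) ≤ n := by exact_mod_cast hn
  rcases lt_trichotomy δ 1 with h | rfl | h
  · have hlt : (1 : ℝ) < 2 ^ (1 - δ) := Real.one_lt_rpow one_lt_two (by linarith)
    have hle : (2 : ℝ) ^ (1 - δ) ≤ 2 ^ (1 : ℝ) :=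
      Real.rpow_le_rpow_of_exponent_le one_le_two (by linarith)
    rw [Real.rpow_one] at hle
    rw [crossingRate, if_neg h.not_gt, if_neg h.ne]
    exact one_div_le_one_div_of_le (by linarith) (by linarith)
  · rw [crossingRate, if_neg (lt_irrefl _), if_pos rfl]
    linarith [Real.log_le_log two_pos hn', Real.log_two_gt_d9]
  · rw [crossingRate, if_pos h]
    have : (1 : ℝ) ≤ (n : ℝ) ^ (1 - 1 / δ) :=
      Real.one_le_rpow (by linarith) (sub_nonneg.2 ((div_le_one hδ).2 h.le))
    linarith

/-- The constant of the dyadic sum `∑ k < T, 2 ^ (k * (δ - 1))`, relative to the crossing rate. For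
`δ ≤ 1` it does not depend on `δ`. -/
noncomputable def geomConst (δ : ℝ) : ℝ :=
  if 1 < δ then (2 : ℝ) ^ (δ - 1) / (2 ^ (δ - 1) - 1) + 1 else 6

theorem geom_sum_le_one_add_crossingRate {δ : ℝ} (hδ : δ < 1) (T n : ℕ) :
    ∑ k ∈ Finset.range T, ((2 : ℝ) ^ (δ - 1)) ^ k ≤ 1 + crossingRate δ n := by
  have hlt : (1 : ℝ) < 2 ^ (1 - δ) := Real.one_lt_rpow one_lt_two (by linarith)
  have hinv : (2 : ℝ) ^ (δ - 1) = (2 ^ (1 - δ))⁻¹ := by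
    rw [← Real.rpow_neg zero_le_two, neg_sub]
  calc ∑ k ∈ Finset.range T, ((2 : ℝ) ^ (δ - 1)) ^ k
      ≤ ((2 : ℝ) ^ (δ - 1)) ^ 0 / (1 - 2 ^ (δ - 1)) := by
        rw [Finset.range_eq_Ico]
        exact geom_sum_Ico_le_of_lt_one (by positivity) (hinv ▸ inv_lt_one_of_one_lt₀ hlt)
    _ = 1 + crossingRate δ n := by
        have : (2 : ℝ) ^ (1 - δ) - 1 ≠ 0 := by linarith
        rw [crossingRate, if_neg hδ.not_gt, if_neg hδ.ne, hinv]
        field_simp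
        ring

theorem geom_sum_add_le_crossingRate {δ : ℝ} (hδ : 1 < δ) {n T : ℕ} (hn : 0 < n)
    (hT : (2 : ℝ) ^ T ≤ (n : ℝ) ^ (1 / δ)) (hT' : (n : ℝ) ^ (1 / δ) ≤ 2 ^ (T + 1)) :
    ∑ k ∈ Finset.range (T + 1), ((2 : ℝ) ^ (δ - 1)) ^ k + n / 2 ^ (T + 1) ≤
      geomConst δ * crossingRate δ n := by
  have hn' : (0 : ℝ) < n := by exact_mod_cast hn
  have hq : (1 : ℝ) < 2 ^ (δ - 1) := Real.one_lt_rpow one_lt_two (by linarith)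
  have : (0 : ℝ) < 2 ^ (δ - 1) - 1 := by linarith
  have hlast : (n : ℝ) / 2 ^ (T + 1) ≤ (n : ℝ) ^ (1 - 1 / δ) := by
    rw [Real.rpow_sub hn', Real.rpow_one]
    gcongr
  have hpow : ((2 : ℝ) ^ (δ - 1)) ^ T ≤ (n : ℝ) ^ (1 - 1 / δ) :=
    calc ((2 : ℝ) ^ (δ - 1)) ^ T = ((2 : ℝ) ^ T) ^ (δ - 1) := by
          rw [← Real.rpow_mul_natCast zero_le_two, mul_comm, Real.rpow_natCast_mul zero_le_two]
      _ ≤ ((n : ℝ) ^ (1 / δ)) ^ (δ - 1) := by gcongr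
      _ = (n : ℝ) ^ (1 - 1 / δ) := by
          rw [← Real.rpow_mul hn'.le]
          congr 1
          field_simp
  rw [crossingRate, if_pos hδ, geomConst, if_pos hδ, add_mul, one_mul]
  refine add_le_add ?_ hlast
  calc ∑ k ∈ Finset.range (T + 1), ((2 : ℝ) ^ (δ - 1)) ^ k
      = (2 ^ (δ - 1) * (2 ^ (δ - 1)) ^ T - 1) / (2 ^ (δ - 1) - 1) := by
        rw [geom_sum_eq hq.ne', pow_succ']
    _ ≤ (2 ^ (δ - 1) * (n : ℝ) ^ (1 - 1 / δ)) / (2 ^ (δ - 1) - 1) := by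
        gcongr
        refine (sub_le_self _ zero_le_one).trans ?_
        gcongr
    _ = _ := mul_div_right_comm _ _ _

theorem exists_geom_sum_add_le_crossingRate {δ : ℝ} (hδ : 0 < δ) {n : ℕ} (hn : 2 ≤ n) :
    ∃ T : ℕ, ∑ k ∈ Finset.range T, ((2 : ℝ) ^ (δ - 1)) ^ k + n / 2 ^ T ≤
      geomConst δ * crossingRate δ n := by
  have hn1 : (1 : ℝ) ≤ n := by exact_mod_cast one_le_two.trans hn
  rcases lt_or_ge 1 δ with h | h
  · obtain ⟨T, hT, hT'⟩ := exists_nat_pow_near (Real.one_le_rpow hn1 (one_div_nonneg.2 hδ.le))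
      one_lt_two
    exact ⟨T + 1, geom_sum_add_le_crossingRate h (by omega) hT hT'.le⟩
  obtain ⟨T, hT, hT'⟩ := exists_nat_pow_near hn1 one_lt_two
  have hlast : (n : ℝ) / 2 ^ (T + 1) ≤ 1 := (div_le_one (by positivity)).2 hT'.le
  have hrate := half_le_crossingRate hδ hn
  refine ⟨T + 1, ?_⟩
  rw [geomConst, if_neg h.not_gt]
  rcases h.lt_or_eq with h | rfl
  · linarith [geom_sum_le_one_add_crossingRate h (T + 1) n]
  · have hlog : (T : ℝ) * Real.log 2 ≤ crossingRate 1 n := by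
      rw [crossingRate, if_neg (lt_irrefl _), if_pos rfl, ← Real.log_pow]
      exact Real.log_le_log (by positivity) hT
    have hhalf : (T : ℝ) * (1 / 2) ≤ T * Real.log 2 := by
      gcongr
      linarith [Real.log_two_gt_d9]
    simp only [sub_self, Real.rpow_zero, one_pow, Finset.sum_const, Finset.card_range, nsmul_eq_mul,
      mul_one, Nat.cast_add, Nat.cast_one]
    linarith

end Rates

section Crossings

variable {E : Type*} [NormedAddCommGroup E] [NormedSpace ℝ E]

theorem abs_sub_dist_le_of_segment_inter_sphere {w : E × E} {o : E} {ρ : ℝ}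
    (h : (segment ℝ w.1 w.2 ∩ Metric.sphere o ρ).Nonempty) :
    |ρ - dist w.1 o| ≤ dist w.1 w.2 := by
  obtain ⟨x, hx, rfl⟩ := h
  calc |dist x o - dist w.1 o| ≤ dist x w.1 := abs_dist_sub_le x w.1 o
    _ ≤ dist w.1 w.2 := by
      rw [dist_comm]
      linarith [dist_add_dist_of_mem_segment hx, dist_nonneg (x := x) (y := w.2)]

variable [FiniteDimensional ℝ E] {P : Finset E} {W : Finset (E × E)} {δ K r : ℝ} {o : E}

theorem card_le_of_pairwise_exchangeStable_of_inter_closedBall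
    (hW : (W : Set (E × E)).Pairwise ExchangeStable) {L : ℝ} (hr : 8 * r < L)
    (hlen : ∀ w ∈ W, L ≤ dist w.1 w.2)
    (hball : ∀ w ∈ W, (segment ℝ w.1 w.2 ∩ Metric.closedBall o r).Nonempty) :
    #W ≤ 2 * 5 ^ finrank ℝ E := by
  choose! p hp using hball
  refine card_le_of_pairwise_exchangeStable_of_close hW hlen p (fun w hw => (hp w hw).1)
    fun v hv w hw => ?_
  linarith [dist_triangle_right (p v) (p w) o, Metric.mem_closedBall.1 (hp v hv).2,
    Metric.mem_closedBall.1 (hp w hw).2]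

-- Starting points that share a net point are so close that only boundedly many of the edges can
-- start there.
theorem HasNetBound.card_le_of_pairwise_exchangeStable (hK : HasNetBound P δ K)
    (hWP : ∀ w ∈ W, w.1 ∈ P) (hW : (W : Set (E × E)).Pairwise ExchangeStable) {ε : ℝ} (hε : 0 < ε)
    (hr : 2 * ε ≤ r) (hlen : ∀ w ∈ W, 16 * ε ≤ dist w.1 w.2)
    (hnear : ∀ w ∈ W, dist w.1 o + ε ≤ r) :
    (#W : ℝ) ≤ 2 * 5 ^ finrank ℝ E * (K * (r / ε) ^ δ) := by
  classical
  obtain ⟨N, hN⟩ := exists_isNet P hε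
  have hcover : ∀ w ∈ W, ∃ y ∈ N, dist w.1 y ≤ ε := fun w hw => hN.2.1 _ (hWP w hw)
  choose! y hyN hy using hcover
  have hfiber : ∀ z, #{w ∈ W | y w = z} ≤ 2 * 5 ^ finrank ℝ E := fun z => by
    refine card_le_of_pairwise_exchangeStable_of_close
      (hW.mono (Finset.coe_subset.2 (Finset.filter_subset _ _))) (L := 16 * ε)
      (fun w hw => hlen w (Finset.mem_filter.1 hw).1) Prod.fst
      (fun w _ => left_mem_segment ℝ w.1 w.2) fun v hv w hw => ?_
    obtain ⟨hvW, rfl⟩ := Finset.mem_filter.1 hv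
    obtain ⟨hwW, hvw⟩ := Finset.mem_filter.1 hw
    have := hvw ▸ hy w hwW
    linarith [dist_triangle_right v.1 w.1 (y v), hy v hvW]
  have hmaps : ∀ w ∈ W, y w ∈ {z ∈ N | dist z o ≤ r} := fun w hw =>
    Finset.mem_filter.2 ⟨hyN w hw, by
      linarith [dist_triangle_left (y w) o w.1, hy w hw, hnear w hw]⟩
  have hball : (#{z ∈ N | dist z o ≤ r} : ℝ) ≤ K * (r / ε) ^ δ := by
    refine le_trans (le_of_eq ?_) (hK ε r hε hr N hN o)
    rw [← Set.ncard_coe_finset, Finset.coe_filter]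
    rfl
  calc (#W : ℝ) ≤ 2 * 5 ^ finrank ℝ E * #{z ∈ N | dist z o ≤ r} := by
        exact_mod_cast Finset.card_le_mul_card_image_of_maps_to hmaps _ fun z _ => hfiber z
    _ ≤ 2 * 5 ^ finrank ℝ E * (K * (r / ε) ^ δ) := by gcongr

/-- A bound for the number of edges of length at least `16 * r / 2 ^ k` that start within `34 * r`
of a given point, in units of `(2 ^ k) ^ δ`. For `δ ≤ 1` it does not depend on `δ`. -/
noncomputable def scaleConst (d : ℕ) (K δ : ℝ) : ℝ := 2 * 5 ^ d * (|K| * 35 ^ max δ 1)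

theorem scaleConst_nonneg (d : ℕ) (K δ : ℝ) : 0 ≤ scaleConst d K δ := by
  unfold scaleConst
  positivity

theorem IsTwoOptimal.card_filter_le_scaleConst (hW : IsTwoOptimal P W) (hK : HasNetBound P δ K)
    (hr : 0 < r) (k : ℕ) :
    (#{w ∈ W | dist w.1 o ≤ 34 * r ∧ 16 * (r / 2 ^ k) ≤ dist w.1 w.2} : ℝ) ≤
      scaleConst (finrank ℝ E) K δ * (2 ^ k) ^ δ := by
  have hε : r / 2 ^ k ≤ r := div_le_self hr.le (one_le_pow₀ one_le_two)
  have hsub := Finset.filter_subset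
    (fun w : E × E => dist w.1 o ≤ 34 * r ∧ 16 * (r / 2 ^ k) ≤ dist w.1 w.2) W
  have hcount := hK.card_le_of_pairwise_exchangeStable (o := o) (ε := r / 2 ^ k) (r := 35 * r)
    (fun w hw => hW.fst_mem w (hsub hw)) (hW.pairwise.mono (Finset.coe_subset.2 hsub))
    (by positivity) (by linarith) (fun w hw => (Finset.mem_filter.1 hw).2.2)
    fun w hw => by linarith [(Finset.mem_filter.1 hw).2.1]
  calc _ ≤ 2 * 5 ^ finrank ℝ E * (K * (35 * r / (r / 2 ^ k)) ^ δ) := hcount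
    _ = 2 * 5 ^ finrank ℝ E * (K * (35 ^ δ * (2 ^ k) ^ δ)) := by
      rw [← Real.mul_rpow (by norm_num) (by positivity)]
      congr 3
      field_simp
    _ ≤ 2 * 5 ^ finrank ℝ E * (|K| * (35 ^ max δ 1 * (2 ^ k) ^ δ)) := by
      gcongr
      · exact le_abs_self K
      · norm_num
      · exact le_max_left δ 1
    _ = _ := by rw [scaleConst]; ring

theorem IsTwoOptimal.sum_dist_le (hW : IsTwoOptimal P W) (hK : HasNetBound P δ K) (hr : 0 < r)
    (T : ℕ) :
    ∑ w ∈ W with dist w.1 o ≤ 34 * r ∧ dist w.1 w.2 ≤ 32 * r, dist w.1 w.2 ≤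
      16 * r * (scaleConst (finrank ℝ E) K δ * ∑ k ∈ Finset.range T, ((2 : ℝ) ^ (δ - 1)) ^ k) +
        32 * r * (#P / 2 ^ T) := by
  set G := {w ∈ W | dist w.1 o ≤ 34 * r ∧ dist w.1 w.2 ≤ 32 * r} with hG
  have hGW : G ⊆ W := Finset.filter_subset _ _
  have hhalf : ∀ k : ℕ, 32 * r / 2 ^ (k + 1) = 16 * (r / 2 ^ k) := fun k => by
    rw [pow_succ]
    field_simp
    norm_num
  have hlevel : ∀ k : ℕ, (#{w ∈ G | 32 * r / 2 ^ (k + 1) ≤ dist w.1 w.2} : ℝ) ≤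
      scaleConst (finrank ℝ E) K δ * (2 ^ k) ^ δ := fun k => by
    refine le_trans ?_ (hW.card_filter_le_scaleConst hK (o := o) hr k)
    rw [hhalf, hG, Finset.filter_filter]
    gcongr
    exact fun h => h.1
  have hpow : ∀ k : ℕ, ((2 : ℝ) ^ k) ^ δ = 2 ^ k * (2 ^ (δ - 1)) ^ k := fun k => by
    rw [← Real.rpow_natCast_mul zero_le_two, mul_comm, Real.rpow_mul_natCast zero_le_two, ← mul_pow,
      Real.rpow_sub_one two_ne_zero, mul_div_cancel₀ _ two_ne_zero]
  calc ∑ w ∈ G, dist w.1 w.2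
      ≤ ∑ k ∈ Finset.range T,
            32 * r / 2 ^ (k + 1) * #{w ∈ G | 32 * r / 2 ^ (k + 1) ≤ dist w.1 w.2} +
          32 * r / 2 ^ T * #G :=
        sum_le_sum_dyadic_card G _ (by positivity) (fun w hw => (Finset.mem_filter.1 hw).2.2) T
    _ ≤ ∑ k ∈ Finset.range T, 16 * (r / 2 ^ k) * (scaleConst (finrank ℝ E) K δ * (2 ^ k) ^ δ) +
          32 * r / 2 ^ T * #P := by
        gcongr with k
        · exact (hhalf k).le
        · exact hlevel k
        · exact (Finset.card_le_card hGW).trans hW.card_le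
    _ = _ := by
        rw [Finset.mul_sum, Finset.mul_sum]
        congr 1
        · refine Finset.sum_congr rfl fun k _ => ?_
          rw [hpow]
          field_simp
        · ring

theorem ncard_segment_inter_sphere_le (hW : (W : Set (E × E)).Pairwise ExchangeStable)
    (hr : 0 < r) {ρ : ℝ} (hρ : ρ ≤ 2 * r) (o : E) :
    {s ∈ (fun w : E × E => segment ℝ w.1 w.2) '' W | (s ∩ Metric.sphere o ρ).Nonempty}.ncard ≤
      2 * 5 ^ finrank ℝ E +
        #{w ∈ {w ∈ W | dist w.1 o ≤ 34 * r ∧ dist w.1 w.2 ≤ 32 * r} |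
          |ρ - dist w.1 o| ≤ dist w.1 w.2} := by
  classical
  set G := {w ∈ W | dist w.1 o ≤ 34 * r ∧ dist w.1 w.2 ≤ 32 * r}
  set Gρ := {w ∈ G | |ρ - dist w.1 o| ≤ dist w.1 w.2}
  set H := {w ∈ W | 32 * r ≤ dist w.1 w.2 ∧
    (segment ℝ w.1 w.2 ∩ Metric.closedBall o (2 * r)).Nonempty}
  have hH : #H ≤ 2 * 5 ^ finrank ℝ E :=
    card_le_of_pairwise_exchangeStable_of_inter_closedBall
      (hW.mono (Finset.coe_subset.2 (Finset.filter_subset _ _))) (L := 32 * r)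
      (by linarith) (fun w hw => (Finset.mem_filter.1 hw).2.1)
      fun w hw => (Finset.mem_filter.1 hw).2.2
  have hsub : {s ∈ (fun w : E × E => segment ℝ w.1 w.2) '' W |
      (s ∩ Metric.sphere o ρ).Nonempty} ⊆
        ((H ∪ Gρ).image fun w => segment ℝ w.1 w.2 : Finset (Set E)) := by
    rintro _ ⟨⟨w, hw, rfl⟩, hwρ⟩
    refine Finset.mem_coe.2 (Finset.mem_image_of_mem _ (Finset.mem_union.2 ?_))
    rcases le_total (32 * r) (dist w.1 w.2) with hlong | hshort
    · have hball : Metric.sphere o ρ ⊆ Metric.closedBall o (2 * r) :=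
        Metric.sphere_subset_closedBall.trans (Metric.closedBall_subset_closedBall hρ)
      exact Or.inl (Finset.mem_filter.2
        ⟨hw, hlong, hwρ.mono (Set.inter_subset_inter_right _ hball)⟩)
    · have hdist := abs_sub_dist_le_of_segment_inter_sphere hwρ
      refine Or.inr (Finset.mem_filter.2 ⟨Finset.mem_filter.2 ⟨hw, ?_, hshort⟩, hdist⟩)
      linarith [neg_le_of_abs_le hdist]
  calc _ ≤ #((H ∪ Gρ).image fun w => segment ℝ w.1 w.2) :=
        (Set.ncard_le_ncard hsub (Finset.finite_toSet _)).trans_eq (Set.ncard_coe_finset _)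
    _ ≤ #(H ∪ Gρ) := Finset.card_image_le
    _ ≤ #H + #Gρ := Finset.card_union_le _ _
    _ ≤ 2 * 5 ^ finrank ℝ E + #Gρ := by gcongr

theorem IsTwoOptimal.exists_sphere_crossing_le (hW : IsTwoOptimal P W) (hK : HasNetBound P δ K)
    (hr : 0 < r) (o : E) (T : ℕ) :
    ∃ ρ ∈ Set.Icc r (2 * r),
      (({s ∈ (fun w : E × E => segment ℝ w.1 w.2) '' W |
        (s ∩ Metric.sphere o ρ).Nonempty}).ncard : ℝ) ≤
      2 * 5 ^ finrank ℝ E + (32 * scaleConst (finrank ℝ E) K δ + 64) *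
        (∑ k ∈ Finset.range T, ((2 : ℝ) ^ (δ - 1)) ^ k + #P / 2 ^ T) := by
  obtain ⟨ρ, hρ, hcross⟩ := exists_card_filter_abs_sub_le
    {w ∈ W | dist w.1 o ≤ 34 * r ∧ dist w.1 w.2 ≤ 32 * r} (fun w => dist w.1 o)
    (fun w => dist w.1 w.2) (fun _ _ => dist_nonneg) hr
  have hcard := Nat.cast_le (α := ℝ).2 (ncard_segment_inter_sphere_le hW.pairwise hr hρ.2 o)
  push_cast at hcard
  refine ⟨ρ, hρ, hcard.trans ?_⟩
  gcongr
  set D := scaleConst (finrank ℝ E) K δ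
  set S := ∑ k ∈ Finset.range T, ((2 : ℝ) ^ (δ - 1)) ^ k
  have hD : 0 ≤ D := scaleConst_nonneg _ _ _
  have hS : 0 ≤ S := Finset.sum_nonneg fun k _ => by positivity
  refine hcross.trans ?_
  calc _ ≤ 2 * (16 * r * (D * S) + 32 * r * (#P / 2 ^ T)) / r := by
        gcongr
        exact hW.sum_dist_le hK hr T
    _ = 32 * D * S + 64 * (#P / 2 ^ T) := by field_simp; ring
    _ ≤ (32 * D + 64) * S + (32 * D + 64) * (#P / 2 ^ T) := by gcongr <;> linarith
    _ = (32 * D + 64) * (S + #P / 2 ^ T) := (mul_add _ _ _).symm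

end Crossings

section Separator

theorem two_rpow_neg_four_mul_le {d : ℕ} (hd : 1 ≤ d) :
    (2 : ℝ) ^ (-(4 * (d : ℝ))) ≤ 1 / (2 * 5 ^ d) := by
  have hpow : (2 : ℝ) ^ (-(4 * (d : ℝ))) = 1 / 16 ^ d := by
    rw [Real.rpow_neg zero_le_two, Real.rpow_mul_natCast zero_le_two, one_div]
    norm_num
  rw [hpow]
  gcongr
  calc (2 : ℝ) * 5 ^ d ≤ 2 ^ d * 5 ^ d := by gcongr; exact le_self_pow₀ one_le_two (by omega)
    _ = 10 ^ d := by rw [← mul_pow]; norm_num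
    _ ≤ 16 ^ d := by gcongr; norm_num

theorem exists_mem_netExponents_crossingRate_eq {X : Type*} [PseudoMetricSpace X]
    {F : Set (Finset X)} {δ : ℝ} (hδ : 0 < δ) (hF : sInf (netExponents F) = δ)
    (hattained : 1 ≤ δ → δ ∈ netExponents F) :
    ∃ δ' ∈ netExponents F, 0 < δ' ∧ ∃ a : ℝ, ∀ n, crossingRate δ' n = a * crossingRate δ n := by
  rcases le_or_gt 1 δ with h | h
  · exact ⟨δ, hattained h, hδ, 1, fun n => (one_mul _).symm⟩
  have hne : (netExponents F).Nonempty := by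
    by_contra hempty
    rw [Set.not_nonempty_iff_eq_empty.1 hempty, Real.sInf_empty] at hF
    exact hδ.ne hF
  obtain ⟨δ', hmem, hlt⟩ := exists_lt_of_csInf_lt hne (hF.trans_lt h)
  have hle : δ ≤ δ' := hF ▸ csInf_le ⟨0, fun _ h => h.1⟩ hmem
  -- Below exponent `1` the rate does not depend on `n`.
  have hconst : ∀ {γ : ℝ}, γ < 1 → ∀ n, crossingRate γ n = crossingRate γ 2 := fun hγ n => by
    simp only [crossingRate, if_neg hγ.not_gt, if_neg hγ.ne]
  have hpos : 0 < crossingRate δ 2 := one_half_pos.trans_le (half_le_crossingRate hδ le_rfl)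
  exact ⟨δ', hmem, hδ.trans_le hle, crossingRate δ' 2 / crossingRate δ 2, fun n => by
    rw [hconst h n, hconst hlt n, div_mul_cancel₀ _ hpos.ne']⟩

/-- The hidden constant of the number of crossing edges. For `δ ≤ 1` it does not depend on `δ`. -/
noncomputable def separatorConst (d : ℕ) (K δ : ℝ) : ℝ :=
  4 * 5 ^ d + (32 * scaleConst d K δ + 64) * geomConst δ

theorem separatorConst_eq_ite (d : ℕ) (K δ : ℝ) :
    separatorConst d K δ = if 1 < δ then separatorConst d K δ else separatorConst d K 1 := by
  split_ifs with h
  · rfl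
  · simp [separatorConst, scaleConst, geomConst, h, max_eq_right (not_lt.1 h)]

variable {E : Type*} [NormedAddCommGroup E] [NormedSpace ℝ E]

theorem IsTwoOptimal.hasBalancedSphere_of_card_le {P : Finset E} {W : Finset (E × E)}
    (hW : IsTwoOptimal P W) {m : ℝ} (hP : 2 ≤ #P) (hPm : #P ≤ m) :
    HasBalancedSphere (1 - 1 / m) P ((fun w : E × E => segment ℝ w.1 w.2) '' W) #P := by
  obtain ⟨o, r, hr, hin, hout⟩ := exists_sphere_ncard_add_one_le hP
  have hfrac : (#P : ℝ) / m ≤ 1 := div_le_one_of_le₀ hPm (hPm.trans' (Nat.cast_nonneg _))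
  have hbalance : ∀ {k : ℕ}, k + 1 ≤ #P → (k : ℝ) ≤ (1 - 1 / m) * #P := fun {k} hk => by
    have hk' : (k : ℝ) + 1 ≤ #P := by exact_mod_cast hk
    rw [sub_mul, one_mul, one_div_mul_eq_div]
    linarith
  have hfin : ((fun w : E × E => segment ℝ w.1 w.2) '' W).Finite := W.finite_toSet.image _
  refine ⟨o, r, hr, hbalance hin, hbalance hout, Nat.cast_le.2 ?_⟩
  calc _ ≤ ((fun w : E × E => segment ℝ w.1 w.2) '' W).ncard :=
        Set.ncard_le_ncard (Set.sep_subset _ _) hfin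
    _ ≤ (W : Set (E × E)).ncard := Set.ncard_image_le W.finite_toSet
    _ = #W := Set.ncard_coe_finset W
    _ ≤ #P := hW.card_le

variable [FiniteDimensional ℝ E]

theorem IsTwoOptimal.hasBalancedSphere {P : Finset E} {W : Finset (E × E)} {δ K : ℝ}
    (hW : IsTwoOptimal P W) (hK : HasNetBound P δ K) (hδ : 0 < δ) (hP : 2 ≤ #P) :
    HasBalancedSphere (1 - 1 / (2 * 5 ^ finrank ℝ E)) P ((fun w : E × E => segment ℝ w.1 w.2) '' W)
      (separatorConst (finrank ℝ E) K δ * crossingRate δ #P) := by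
  obtain ⟨T, hT⟩ := exists_geom_sum_add_le_crossingRate hδ hP
  have hD := scaleConst_nonneg (finrank ℝ E) K δ
  have hrate := half_le_crossingRate hδ hP
  set S := ∑ k ∈ Finset.range T, ((2 : ℝ) ^ (δ - 1)) ^ k + #P / 2 ^ T
  have hS₀ : 0 ≤ S := by positivity
  have hfirst : 2 * 5 ^ finrank ℝ E ≤ 4 * 5 ^ finrank ℝ E * crossingRate δ #P := by
    nlinarith [(by positivity : (0 : ℝ) < 5 ^ finrank ℝ E)]
  have hbound : 2 * 5 ^ finrank ℝ E + (32 * scaleConst (finrank ℝ E) K δ + 64) * S ≤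
      separatorConst (finrank ℝ E) K δ * crossingRate δ #P :=
    calc _ ≤ 4 * 5 ^ finrank ℝ E * crossingRate δ #P +
          (32 * scaleConst (finrank ℝ E) K δ + 64) * (geomConst δ * crossingRate δ #P) :=
          add_le_add hfirst (by gcongr)
      _ = _ := by rw [separatorConst]; ring
  rcases le_or_gt #P (2 * 5 ^ finrank ℝ E) with hsmall | hlarge
  · have hsmall' : (#P : ℝ) ≤ 2 * 5 ^ finrank ℝ E := by exact_mod_cast hsmall
    refine (hW.hasBalancedSphere_of_card_le hP hsmall').mono le_rfl
      (le_trans ?_ hbound)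
    nlinarith
  · obtain ⟨o, r, hr, hbalanced⟩ := exists_balanced_annulus hlarge
    obtain ⟨ρ, hρ, hcross⟩ := hW.exists_sphere_crossing_le hK hr o T
    exact ⟨o, ρ, hr.trans_le hρ.1, (hbalanced ρ hρ).1, (hbalanced ρ hρ).2, hcross.trans hbound⟩

theorem IsTwoOptimal.hasBalancedSphere_two_rpow {P : Finset E} {W : Finset (E × E)} {δ K : ℝ}
    (hW : IsTwoOptimal P W) (hK : HasNetBound P δ K) (hδ : 0 < δ) (hP : 2 ≤ #P) :
    HasBalancedSphere (1 - (2 : ℝ) ^ (-(4 * (finrank ℝ E : ℝ)))) P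
      ((fun w : E × E => segment ℝ w.1 w.2) '' W)
      (separatorConst (finrank ℝ E) K δ * crossingRate δ #P) := by
  refine (hW.hasBalancedSphere hK hδ hP).mono (sub_le_sub_left ?_ 1) le_rfl
  obtain ⟨p, -, q, -, hpq⟩ := Finset.one_lt_card.1 hP
  have : Nontrivial E := ⟨p, q, hpq⟩
  exact two_rpow_neg_four_mul_le Module.finrank_pos

theorem theorem4_general :
    (∀ δ : ℝ, 0 < δ → ∀ F : Set (Finset E), sInf (netExponents F) = δ →
      (1 ≤ δ → δ ∈ netExponents F) →
      ∃ C : ℝ, ∀ P ∈ F, 2 ≤ #P → ∀ W : Finset (E × E), IsTwoOptimal P W →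
        HasBalancedSphere (1 - (2 : ℝ) ^ (-(4 * (finrank ℝ E : ℝ)))) P
          ((fun w : E × E => segment ℝ w.1 w.2) '' W) (C * crossingRate δ #P)) ∧
    (∀ K : ℝ, ∃ (A : ℝ) (B : ℝ → ℝ), ∀ δ : ℝ, 0 < δ → ∀ F : Set (Finset E),
      (∀ P ∈ F, HasNetBound P δ K) → ∀ P ∈ F, 2 ≤ #P → ∀ W : Finset (E × E), IsTwoOptimal P W →
        HasBalancedSphere (1 - (2 : ℝ) ^ (-(4 * (finrank ℝ E : ℝ)))) P
          ((fun w : E × E => segment ℝ w.1 w.2) '' W)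
          ((if 1 < δ then B δ else A) * crossingRate δ #P)) := by
  refine ⟨fun δ hδ F hF hattained => ?_, fun K => ?_⟩
  · obtain ⟨δ', ⟨-, K, hK⟩, hδ', a, ha⟩ := exists_mem_netExponents_crossingRate_eq hδ hF hattained
    refine ⟨separatorConst (finrank ℝ E) K δ' * a, fun P hP hP2 W hW => ?_⟩
    rw [mul_assoc, ← ha]
    exact hW.hasBalancedSphere_two_rpow (hK P hP) hδ' hP2
  · refine ⟨separatorConst (finrank ℝ E) K 1, separatorConst (finrank ℝ E) K,
      fun δ hδ F hF P hP hP2 W hW => ?_⟩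
    rw [← separatorConst_eq_ite]
    exact hW.hasBalancedSphere_two_rpow (hF P hP) hδ hP2

end Separator

/-- The constant `c` is absolute. First part: for a family of fractal dimension `δ`, whose
defining bound holds at the exponent `δ` itself if `δ ≥ 1`. Second part: how the hidden constant
depends on the data (on `d`, on the constant `K` of the net bound, and on `δ` only if `δ > 1`). -/
theorem theorem4 :
    ∃ c : ℝ, 0 < c ∧ ∀ d : ℕ, 2 ≤ d →
      (∀ (δ : ℝ), 0 < δ → δ ≤ d → ∀ F : Set (Finset (Euc d)),
        fractalDim F = δ → (1 ≤ δ → δ ∈ fractalExponents F) →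
        ∃ C : ℝ, ∀ P ∈ F, 2 ≤ P.card → ∀ e : Tour P, IsOptimalTour e →
          HasSphereSeparator c P (tourEdges e) (C * crossingRate δ P.card)) ∧
      (∀ K : ℝ, ∃ (A : ℝ) (B : ℝ → ℝ), ∀ (δ : ℝ), 0 < δ → δ ≤ d →
        ∀ F : Set (Finset (Euc d)), NetBound F δ K →
        ∀ P ∈ F, 2 ≤ P.card → ∀ e : Tour P, IsOptimalTour e →
          HasSphereSeparator c P (tourEdges e)
            ((if 1 < δ then B δ else A) * crossingRate δ P.card)) := by
  refine ⟨4, four_pos, fun d _ => ?_⟩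
  obtain ⟨hdim, hnet⟩ := theorem4_general (E := Euc d)
  simp only [finrank_euclideanSpace_fin] at hdim hnet
  refine ⟨fun δ hδ _ F hF hattained => ?_, fun K => ?_⟩
  · obtain ⟨C, hC⟩ := hdim δ hδ F hF hattained
    exact ⟨C, fun P hP hP2 e he => image_segment_orientedEdges e ▸ hC P hP hP2 _ he.isTwoOptimal⟩
  · obtain ⟨A, B, hAB⟩ := hnet K
    exact ⟨A, B, fun δ hδ _ F hF P hP hP2 e he =>
      image_segment_orientedEdges e ▸ hAB δ hδ F hF P hP hP2 _ he.isTwoOptimal⟩
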